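/- An oriented virtual knot diagram $D$ is an oriented closed immersed ($C^1$) curve in the plane whose multiple points are finitely many transverse double points, some of them marked as classical crossings (with a choice of over-branch and under-branch), the others being virtual crossings. For an ordered pair of branches $(\alpha,\beta)$ at a crossing put $\varepsilon(\alpha,\beta)=+1$ if $\beta$ crosses $\alpha$ from right to left and $\varepsilon(\alpha,\beta)=-1$ if $\beta$ crosses $\alpha$ from left to right. The sign of a classical crossing $c$ is $\operatorname{sign}(c)=\varepsilon(\text{over-branch},\text{under-branch})$. A long arc of $D$ is the part of the curve between two consecutive passages through classical crossings; the long arcs are the edges of the covering graph $\tilde D$, whose vertices are the classical crossings. The virtual index cocycle $vi_D\in C^1(\tilde D,\mathbb Z)$ assigns to a long arc $e$ the sum of $\varepsilon(\alpha,\beta)$ over all passages of $e$ through virtual crossings, where $\alpha$ is the passing branch (part of $e$) and $\beta$ is the other branch at that crossing. The oriented smoothing at a classical crossing $c$ splits $D$ into two closed curves, the left half $D^l_c$ and the right half $D^r_c$, where $D^l_c$ is the one that leaves $c$ along the left outgoing branch. Let $D^+_c=D^l_c$ if $\operatorname{sign}(c)=+1$ and $D^+_c=D^r_c$ if $\operatorname{sign}(c)=-1$.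 The virtual index of $c$ is $vInd_D(c)=vi_D(D^+_c)$, the sum of $vi_D$ over the long arcs that form $D^+_c$. Cheng's index $Ind_D(c)$ is the sum, over all passages of $D^+_c$ through classical crossings (not counting the point $c$ at which $D^+_c$ starts and ends), of the intersection number at that passage, which is $+1$ if the other branch crosses $D^+_c$ from left to right and $-1$ if it crosses from right to left. Then for every oriented virtual knot diagram $D$ and every classical crossing $c$ of $D$, $$vInd_D(c)=Ind_D(c).$$ -/

import Mathlib

/-- An oriented closed `C¹` immersed curve in the plane: a `1`-periodic `C¹` map `ℝ → ℝ²` with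
nowhere vanishing derivative.  The orientation is that of increasing parameter. -/
structure ImmersedClosedCurve where
  curve : ℝ → ℝ × ℝ
  contDiff : ContDiff ℝ 1 curve
  periodic : Function.Periodic curve 1
  immersion : ∀ x, deriv curve x ≠ 0

namespace ImmersedClosedCurve

theorem periodic_deriv (γ : ImmersedClosedCurve) : Function.Periodic (deriv γ.curve) 1 := by
  intro x
  have h : (fun y => γ.curve (y + 1)) = γ.curve := funext γ.periodic
  rw [← deriv_comp_add_const, h]

/-- The curve as a map from the circle `ℝ / ℤ`. -/
def point (γ : ImmersedClosedCurve) : UnitAddCircle → ℝ × ℝ := γ.periodic.lift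

/-- The velocity vector of the curve, as a function on the circle `ℝ / ℤ`. -/
noncomputable def velocity (γ : ImmersedClosedCurve) : UnitAddCircle → ℝ × ℝ :=
  γ.periodic_deriv.lift

/-- The oriented area `det (v(s), v(t))` spanned by the velocities at the parameters `s`, `t`.
It is positive when the frame `(v(s), v(t))` is counterclockwise, that is, when the branch at `t`
crosses the branch at `s` from right to left. -/
noncomputable def det (γ : ImmersedClosedCurve) (s t : UnitAddCircle) : ℝ :=
  (γ.velocity s).1 * (γ.velocity t).2 - (γ.velocity s).2 * (γ.velocity t).1

/-- Ordered pairs of distinct parameters at which the curve passes through the same point. -/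
def doublePairs (γ : ImmersedClosedCurve) : Set (UnitAddCircle × UnitAddCircle) :=
  {p | p.1 ≠ p.2 ∧ γ.point p.1 = γ.point p.2}

end ImmersedClosedCurve

/-- An oriented virtual knot diagram: a closed immersed plane curve whose multiple points are
finitely many transverse double points, some of which are marked as classical crossings and carry
the information which branch passes over; all the other double points are virtual crossings. -/
structure VirtualKnotDiagram extends ImmersedClosedCurve where
  finite_doublePairs : toImmersedClosedCurve.doublePairs.Finite
  no_triple : ∀ s t u, (s, t) ∈ toImmersedClosedCurve.doublePairs →
    (s, u) ∈ toImmersedClosedCurve.doublePairs → t = u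
  transverse : ∀ s t, (s, t) ∈ toImmersedClosedCurve.doublePairs →
    toImmersedClosedCurve.det s t ≠ 0
  /-- The classical crossings, each given as the pair (parameter of the over-passage, parameter of
  the under-passage). -/
  crossings : Set (UnitAddCircle × UnitAddCircle)
  crossings_subset : crossings ⊆ toImmersedClosedCurve.doublePairs
  swap_notMem : ∀ c ∈ crossings, c.swap ∉ crossings

namespace VirtualKnotDiagram

/-- Classical crossings of the diagram. -/
def Crossing (D : VirtualKnotDiagram) : Type := {c // c ∈ D.crossings}

/-- Parameter of the over-passage of a classical crossing. -/
def Crossing.over {D : VirtualKnotDiagram} (c : D.Crossing) : UnitAddCircle := c.1.1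

/-- Parameter of the under-passage of a classical crossing. -/
def Crossing.under {D : VirtualKnotDiagram} (c : D.Crossing) : UnitAddCircle := c.1.2

/-- The sign of a classical crossing: `+1` if the frame (over, under) is counterclockwise,
`-1` otherwise. -/
noncomputable def Crossing.sign {D : VirtualKnotDiagram} (c : D.Crossing) : ℤ :=
  SignType.sign (D.det c.over c.under)

/-- Ordered pairs (parameter of one passage, parameter of the other passage) through classical
crossings; each crossing gives two of them. -/
def classicalPairs (D : VirtualKnotDiagram) : Set (UnitAddCircle × UnitAddCircle) :=
  {p | p ∈ D.crossings ∨ p.swap ∈ D.crossings}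

theorem classicalPairs_subset (D : VirtualKnotDiagram) : D.classicalPairs ⊆ D.doublePairs := by
  rintro p (h | h)
  · exact D.crossings_subset h
  · have := D.crossings_subset h
    exact ⟨this.1.symm, this.2.symm⟩

/-- Ordered pairs (parameter of one passage, parameter of the other passage) through virtual
crossings; each virtual crossing gives two of them. -/
def virtualPairs (D : VirtualKnotDiagram) : Set (UnitAddCircle × UnitAddCircle) :=
  D.doublePairs \ D.classicalPairs

theorem finite_classicalPairs (D : VirtualKnotDiagram) : D.classicalPairs.Finite :=
  D.finite_doublePairs.subset D.classicalPairs_subset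

theorem finite_virtualPairs (D : VirtualKnotDiagram) : D.virtualPairs.Finite :=
  D.finite_doublePairs.subset Set.sdiff_subset

/-- The parameters at which the curve passes through a classical crossing. -/
def classicalPassages (D : VirtualKnotDiagram) : Set UnitAddCircle :=
  Prod.fst '' D.classicalPairs

/-- The pairs `(a, b)` of consecutive classical passages.  `Set.cIoo a b` is the open arc of the
circle from `a` to `b` in the direction of increasing parameter. -/
def longArcs (D : VirtualKnotDiagram) : Set (UnitAddCircle × UnitAddCircle) :=
  {e | e.1 ∈ D.classicalPassages ∧ e.2 ∈ D.classicalPassages ∧ e.1 ≠ e.2 ∧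
    Disjoint (Set.cIoo e.1 e.2) D.classicalPassages}

/-- The long arcs of the diagram, i.e. the edges of its covering graph (whose vertices are the
classical crossings). -/
def LongArc (D : VirtualKnotDiagram) : Type := {e // e ∈ D.longArcs}

instance (D : VirtualKnotDiagram) : Finite D.LongArc := by
  have h : D.classicalPassages.Finite := D.finite_classicalPairs.image _
  exact ((h.prod h).subset fun e he => ⟨he.1, he.2.1⟩).to_subtype

noncomputable instance (D : VirtualKnotDiagram) : Fintype D.LongArc := Fintype.ofFinite _

/-- The interior of a long arc, as a set of parameters. -/
def LongArc.interior {D : VirtualKnotDiagram} (e : D.LongArc) : Set UnitAddCircle :=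
  Set.cIoo e.1.1 e.1.2

open Classical in
/-- The virtual index cocycle, a `1`-cochain on the covering graph: its value on a long arc is the
sum, over the passages of the arc through virtual crossings, of the sign of the virtual crossing
with respect to the passing branch.  This sign is `+1` if the other branch crosses the passing one
from right to left, and `-1` if it crosses from left to right. -/
noncomputable def virtualIndexCocycle (D : VirtualKnotDiagram) (e : D.LongArc) : ℤ :=
  ∑ p ∈ D.finite_virtualPairs.toFinset with p.1 ∈ e.interior, (SignType.sign (D.det p.1 p.2) : ℤ)

/-- An oriented arc of the circle, from `source` to `target` in the direction of increasing
parameter. -/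
structure Arc where
  source : UnitAddCircle
  target : UnitAddCircle

/-- The open arc, as a set of parameters. -/
def Arc.interior (A : Arc) : Set UnitAddCircle := Set.cIoo A.source A.target

open Classical in
/-- The value of a `1`-cochain on an arc that joins two classical passages: the sum of its values
on the long arcs of which the arc consists. -/
noncomputable def eval {D : VirtualKnotDiagram} (f : D.LongArc → ℤ) (A : Arc) : ℤ :=
  ∑ e : D.LongArc with e.interior ⊆ A.interior, f e

open Classical in
/-- The left half of the diagram at `c`: the oriented smoothing at `c` splits the diagram into two
closed curves, and the left half is the one which leaves `c` along the left outgoing branch (and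
comes back along the left incoming branch). The under-branch is the left outgoing one exactly if
the frame (over, under) is counterclockwise. -/
noncomputable def Crossing.leftHalf {D : VirtualKnotDiagram} (c : D.Crossing) : Arc :=
  if 0 < D.det c.over c.under then ⟨c.under, c.over⟩ else ⟨c.over, c.under⟩

open Classical in
/-- The right half of the diagram at `c`: the other half of the oriented smoothing at `c`. -/
noncomputable def Crossing.rightHalf {D : VirtualKnotDiagram} (c : D.Crossing) : Arc :=
  if 0 < D.det c.over c.under then ⟨c.over, c.under⟩ else ⟨c.under, c.over⟩

/-- The positive half of the diagram at `c`: the left half if `c` is positive, the right half if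
`c` is negative. -/
noncomputable def Crossing.positiveHalf {D : VirtualKnotDiagram} (c : D.Crossing) : Arc :=
  if c.sign = 1 then c.leftHalf else c.rightHalf

/-- The virtual index of a classical crossing: the value of the virtual index cocycle on the
positive half. -/
noncomputable def virtualIndex (D : VirtualKnotDiagram) (c : D.Crossing) : ℤ :=
  eval D.virtualIndexCocycle c.positiveHalf

open Classical in
/-- The (classical) index of a classical crossing: the sum of the intersection numbers of the
classical crossings over all passages of the positive half through classical crossings (other than
the point `c` at which the half starts and ends).  The intersection number at such a passage is
`+1` if the other branch crosses the positive half from left to right, and `-1` if it crosses from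
right to left. -/
noncomputable def index (D : VirtualKnotDiagram) (c : D.Crossing) : ℤ :=
  ∑ p ∈ D.finite_classicalPairs.toFinset with p.1 ∈ c.positiveHalf.interior,
    (SignType.sign (D.det p.2 p.1) : ℤ)

end VirtualKnotDiagram

/-!
Call the positive half of a classical crossing `c` the arc `A` and the rest of the curve `B`. Both
indices add up signs of passages of `A` through double points, the virtual index over the virtual
passages and Cheng's index, with the opposite sign convention, over the classical ones. Hence the
theorem says that the signs of all passages of `A` have sum zero. A double point with both passages
on `A` contributes two opposite signs, so what remains is the intersection number of `A` and `B`,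
two closed loops that touch at `c` without crossing.

For loops `α`, `β` consider the difference map `F (s, t) = β t - α s` on the rectangle of
parameters. The form `∂₁H dx ∧ dy` is exact, so its pull-back under `F` has integral zero. If `∂₁H`
is a bump with small support near the origin, the change of variables formula around each transverse
zero of `F` evaluates the same integral, up to sign, as the intersection number times the mass of
the bump. The corners of the rectangle are zeros of `F` as well, but since the loops lie on
different sides of a line through `c` near their base point, `F` maps the part of the rectangle near
its corners into a half-plane, and a bump supported in the opposite half-plane does not see them.
-/

open MeasureTheory Set Topology

section CircularOrder

variable {α : Type*} [CircularOrder α] {P : Set α} {a b a' b' u o x y : α}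

theorem left_notMem_cIoo : a ∉ cIoo a b :=
  sbtw_irrefl_left

theorem right_notMem_cIoo : b ∉ cIoo a b :=
  sbtw_irrefl_right

theorem ne_of_mem_cIoo (hx : x ∈ cIoo a b) : a ≠ b := by
  rintro rfl
  exact sbtw_irrefl_left_right hx

theorem mem_cIoo_or_mem_cIoo_swap (hab : a ≠ b) (hxa : x ≠ a) (hxb : x ≠ b) :
    x ∈ cIoo a b ∨ x ∈ cIoo b a := by
  by_contra! h
  have hab' : btw a x b := btw_iff_not_sbtw.2 h.2
  have hba : btw b x a := btw_iff_not_sbtw.2 h.1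
  rcases hab'.antisymm hba with h | h | h
  exacts [hxa h.symm, hxb h, hab h.symm]

theorem disjoint_cIoo_swap (a b : α) : Disjoint (cIoo a b) (cIoo b a) :=
  disjoint_left.2 fun _ hab hba => sbtw_asymm hab hba

theorem cIoo_subset_cIoo_left (hx : x ∈ cIoo a b) : cIoo a x ⊆ cIoo a b :=
  fun _ hy => sbtw_trans_right hy hx

theorem cIoo_subset_cIoo_right (hx : x ∈ cIoo a b) : cIoo x b ⊆ cIoo a b :=
  fun _ hy => hx.trans_left hy

theorem cIoo_subset_cIoo_of_left_notMem (hux : u ≠ x) (hu : u ∉ cIoo a x) :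
    cIoo a x ⊆ cIoo u x := by
  intro y hy
  have hyu : y ≠ u := fun h => hu (h ▸ hy)
  have hyx : y ≠ x := fun h => right_notMem_cIoo (h ▸ hy)
  refine (mem_cIoo_or_mem_cIoo_swap hux hyu hyx).resolve_right fun h => hu ?_
  exact hy.trans_left h.cyclic_left

theorem cIoo_subset_cIoo_of_right_notMem (hox : o ≠ x) (ho : o ∉ cIoo x b) :
    cIoo x b ⊆ cIoo x o :=
  cIoo_subset_cIoo_of_left_notMem (α := αᵒᵈ) hox ho

theorem eq_or_mem_cIoo_or_mem_cIoo (hx : x ∈ cIoo a b) (hy : y ∈ cIoo a b) :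
    y = x ∨ y ∈ cIoo a x ∨ y ∈ cIoo x b := by
  by_contra! ⟨hyx, hax, hxb⟩
  have hxa : x ≠ a := fun h => left_notMem_cIoo (h ▸ hx)
  have hya : y ≠ a := fun h => left_notMem_cIoo (h ▸ hy)
  have hxya : y ∈ cIoo x a := (mem_cIoo_or_mem_cIoo_swap hxa hyx hya).resolve_right hax
  exact hxb (sbtw_trans_right hy.cyclic_left hxya.cyclic_left).cyclic_right

theorem cIoo_subset_cIoo_of_notMem (hx : x ∈ cIoo a b) (hxuo : x ∈ cIoo u o)
    (hu : u ∉ cIoo a b) (ho : o ∉ cIoo a b) : cIoo a b ⊆ cIoo u o := by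
  intro y hy
  have hux : u ≠ x := fun h => hu (h ▸ hx)
  have hox : o ≠ x := fun h => ho (h ▸ hx)
  rcases eq_or_mem_cIoo_or_mem_cIoo hx hy with rfl | hy | hy
  · exact hxuo
  · exact cIoo_subset_cIoo_left hxuo
      (cIoo_subset_cIoo_of_left_notMem hux (notMem_subset (cIoo_subset_cIoo_left hx) hu) hy)
  · exact cIoo_subset_cIoo_right hxuo
      (cIoo_subset_cIoo_of_right_notMem hox (notMem_subset (cIoo_subset_cIoo_right hx) ho) hy)

theorem left_eq_left_of_notMem_cIoo (hx : x ∈ cIoo a b) (hx' : x ∈ cIoo a' b')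
    (ha : a ∉ cIoo a' b') (ha' : a' ∉ cIoo a b) : a = a' := by
  by_contra hne
  have hxa : x ≠ a := fun h => ha (h ▸ hx')
  have hxa' : x ≠ a' := fun h => ha' (h ▸ hx)
  rcases mem_cIoo_or_mem_cIoo_swap hne hxa hxa' with h | h
  · exact ha (cIoo_subset_cIoo_left hx' h.cyclic_right)
  · exact ha' (cIoo_subset_cIoo_left hx h.cyclic_right)

theorem right_eq_right_of_notMem_cIoo (hx : x ∈ cIoo a b) (hx' : x ∈ cIoo a' b')
    (hb : b ∉ cIoo a' b') (hb' : b' ∉ cIoo a b) : b = b' :=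
  left_eq_left_of_notMem_cIoo (α := αᵒᵈ) hx hx' hb hb'

theorem exists_mem_disjoint_cIoo_right (hP : P.Finite) (hne : P.Nonempty) (x : α) :
    ∃ b ∈ P, Disjoint (cIoo x b) P := by
  have : IsStrictOrder α (sbtw x) :=
    { irrefl := fun _ => sbtw_irrefl_right, trans := fun _ _ _ hyz hzw => sbtw_trans_right hyz hzw }
  obtain ⟨u, hu⟩ := hne
  obtain ⟨⟨b, hb⟩, -, hmin⟩ := (hP.wellFoundedOn (r := sbtw x)).has_min univ ⟨⟨u, hu⟩, mem_univ _⟩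
  exact ⟨b, hb, disjoint_left.2 fun y hy hyP => hmin ⟨y, hyP⟩ (mem_univ _) hy⟩

theorem exists_mem_disjoint_cIoo_left (hP : P.Finite) (hne : P.Nonempty) (x : α) :
    ∃ a ∈ P, Disjoint (cIoo a x) P :=
  exists_mem_disjoint_cIoo_right (α := αᵒᵈ) hP hne x

theorem exists_mem_cIoo_disjoint (hP : P.Finite) (hxP : x ∉ P) (hu : u ∈ P) (ho : o ∈ P)
    (huo : u ≠ o) : ∃ a ∈ P, ∃ b ∈ P, x ∈ cIoo a b ∧ Disjoint (cIoo a b) P := by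
  obtain ⟨a, ha, hax⟩ := exists_mem_disjoint_cIoo_left hP ⟨u, hu⟩ x
  obtain ⟨b, hb, hxb⟩ := exists_mem_disjoint_cIoo_right hP ⟨u, hu⟩ x
  have hne : ∀ y ∈ P, x ≠ y := fun y hy h => hxP (h ▸ hy)
  have hab : a ≠ b := by
    rintro rfl
    have eq_a : ∀ y ∈ P, y = a := fun y hy => by_contra fun hya =>
      (mem_cIoo_or_mem_cIoo_swap (hne a ha) (hne y hy).symm hya).elim
        (disjoint_right.1 hxb hy) (disjoint_right.1 hax hy)
    exact huo ((eq_a u hu).trans (eq_a o ho).symm)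
  have hx : x ∈ cIoo a b := (mem_cIoo_or_mem_cIoo_swap hab (hne a ha) (hne b hb)).resolve_right
    fun h => disjoint_right.1 hxb ha h.cyclic_left
  refine ⟨a, ha, b, hb, hx, disjoint_left.2 fun y hy hyP => ?_⟩
  rcases eq_or_mem_cIoo_or_mem_cIoo hx hy with rfl | hy | hy
  exacts [hxP hyP, disjoint_left.1 hax hy hyP, disjoint_left.1 hxb hy hyP]

end CircularOrder

section AddCircle

variable {𝕜 : Type*} [AddCommGroup 𝕜] [LinearOrder 𝕜] [IsOrderedAddMonoid 𝕜] [Archimedean 𝕜]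
  {p a b x : 𝕜} [hp : Fact (0 < p)]

theorem coe_mem_cIoo_coe_iff (hb : b ∈ Ico a (a + p)) (hx : x ∈ Ico a (a + p)) :
    (x : AddCircle p) ∈ cIoo (a : AddCircle p) b ↔ x ∈ Ioo a b := by
  have hb' : toIcoMod hp.out a b = b := (toIcoMod_eq_self hp.out).2 hb
  have hbtw : btw (b : AddCircle p) x a ↔ b ≤ toIocMod hp.out a x := by
    rw [btw_cyclic]
    exact QuotientAddGroup.btw_coe_iff.trans (by rw [hb'])
  rw [mem_cIoo, sbtw_iff_not_btw, hbtw, not_le, mem_Ioo]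
  rcases hx.1.eq_or_lt with rfl | hax
  · rw [toIocMod_apply_left]
    exact iff_of_false hb.2.not_gt fun h => h.1.false
  · rw [(toIocMod_eq_self hp.out).2 ⟨hax, hx.2.le⟩, and_iff_right hax]

theorem bijOn_coe_Ioo_cIoo (hb : b ∈ Ico a (a + p)) :
    BijOn ((↑) : 𝕜 → AddCircle p) (Ioo a b) (cIoo (a : AddCircle p) b) := by
  have hsub : Ioo a b ⊆ Ico a (a + p) := fun x hx => ⟨hx.1.le, hx.2.trans hb.2⟩
  refine ⟨fun x hx => (coe_mem_cIoo_coe_iff hb (hsub hx)).2 hx, ?_, fun y hy => ?_⟩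
  · exact fun x hx y hy h => (AddCircle.coe_eq_coe_iff_of_mem_Ico (hsub hx) (hsub hy)).1 h
  · have hlift := AddCircle.coe_equivIco (a := a) (y := y)
    refine ⟨AddCircle.equivIco p a y, ?_, hlift⟩
    rwa [← hlift, coe_mem_cIoo_coe_iff hb (Subtype.prop _)] at hy

end AddCircle

section DegreeFormula

variable {E : Type*} [NormedAddCommGroup E] [NormedSpace ℝ E] [FiniteDimensional ℝ E]
  [MeasurableSpace E] [BorelSpace E] (μ : Measure E) [μ.IsAddHaarMeasure] {F : E → E}

theorem exists_isOpen_setIntegral_comp_mul_det (hF : ContDiff ℝ 1 F) {z : E}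
    (hdet : (fderiv ℝ F z).det ≠ 0) {W : Set E} (hW : W ∈ 𝓝 z) :
    ∃ U ⊆ W, IsOpen U ∧ z ∈ U ∧ ∃ O ∈ 𝓝 (F z), ∀ φ : E → ℝ, Function.support φ ⊆ O →
      ∫ w in U, φ (F w) * (fderiv ℝ F w).det ∂μ =
        SignType.sign (fderiv ℝ F z).det * ∫ p, φ p ∂μ := by
  have hstrict : HasStrictFDerivAt F
      ((fderiv ℝ F z).toContinuousLinearEquivOfDetNeZero hdet : E →L[ℝ] E) z :=
    hF.contDiffAt.hasStrictFDerivAt one_ne_zero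
  have hcont : Continuous fun w => (fderiv ℝ F w).det :=
    ContinuousLinearMap.continuous_det.comp (hF.continuous_fderiv one_ne_zero)
  have hsign : ∀ᶠ w in 𝓝 z,
      SignType.sign (fderiv ℝ F w).det = SignType.sign (fderiv ℝ F z).det :=
    ((continuousAt_sign_of_ne_zero hdet).comp (f := fun w => (fderiv ℝ F w).det)
      hcont.continuousAt).eventually_mem
      (mem_nhds_discrete.2 (mem_singleton _))
  obtain ⟨V, hV, hVo, hzV⟩ := eventually_nhds_iff.1 (hsign.and hW)
  set e := (hstrict.toOpenPartialHomeomorph F).restrOpen V hVo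
  have he : (e : E → E) = F := hstrict.toOpenPartialHomeomorph_coe
  have hze : z ∈ e.source := ⟨hstrict.mem_toOpenPartialHomeomorph_source, hzV⟩
  refine ⟨e.source, fun w hw => (hV w hw.2).2, e.open_source, hze, e.target,
    e.open_target.mem_nhds (he ▸ e.map_source hze), fun φ hφ => ?_⟩
  have hderiv : ∀ w ∈ e.source, HasFDerivAt e (fderiv ℝ F w) w := fun w _ =>
    he ▸ (hF.differentiable one_ne_zero w).hasFDerivAt
  have hφ0 : ∀ p ∉ e.target, φ p = 0 := fun p hp => Function.notMem_support.1 fun h => hp (hφ h)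
  rw [← setIntegral_eq_integral_of_forall_compl_eq_zero hφ0,
    integral_target_eq_integral_abs_det_fderiv_smul μ hderiv, ← integral_const_mul]
  refine setIntegral_congr_fun e.open_source.measurableSet fun w hw => ?_
  calc φ (F w) * (fderiv ℝ F w).det
      = φ (F w) * (SignType.sign (fderiv ℝ F w).det * |(fderiv ℝ F w).det|) := by
        rw [sign_mul_abs]
    _ = SignType.sign (fderiv ℝ F z).det * (|(fderiv ℝ F w).det| • φ (e w)) := by
        rw [(hV w hw.2).1, he, smul_eq_mul]; ring

theorem exists_nhds_zero_setIntegral_comp_mul_det (hF : ContDiff ℝ 1 F) {R N : Set E}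
    (hR : IsCompact R) (hN : IsOpen N) {Z : Finset E} (hZR : ∀ z ∈ Z, R ∈ 𝓝 z)
    (hZ : ∀ z ∈ Z, F z = 0) (hdet : ∀ z ∈ Z, (fderiv ℝ F z).det ≠ 0)
    (hzeros : ∀ z ∈ R, F z = 0 → z ∈ Z ∨ z ∈ N) :
    ∃ O ∈ 𝓝 (0 : E), ∀ φ : E → ℝ, Continuous φ → Function.support φ ⊆ O →
      Disjoint (Function.support φ) (F '' (R ∩ N)) →
      ∫ w in R, φ (F w) * (fderiv ℝ F w).det ∂μ =
        (∑ z ∈ Z, (SignType.sign (fderiv ℝ F z).det : ℝ)) * ∫ p, φ p ∂μ := by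
  obtain ⟨W, hW, hWdisj⟩ := Z.finite_toSet.t2_separation
  choose! U hUW hUo hzU O hO hint using fun z (hz : z ∈ Z) =>
    exists_isOpen_setIntegral_comp_mul_det μ hF (hdet z hz)
      (Filter.inter_mem ((hW z).2.mem_nhds (hW z).1) (hZR z hz))
  have hUR : ⋃ z ∈ Z, U z ⊆ R := iUnion₂_subset fun z hz w hw => (hUW z hz hw).2
  have hUdisj : (Z : Set E).PairwiseDisjoint U := fun z hz z' hz' hne =>
    (hWdisj hz hz' hne).mono (fun w hw => (hUW z hz hw).1) (fun w hw => (hUW z' hz' hw).1)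
  set K := R \ (N ∪ ⋃ z ∈ Z, U z)
  have hK : IsCompact K := hR.diff (hN.union (isOpen_biUnion hUo))
  have hK0 : (0 : E) ∉ F '' K := by
    rintro ⟨w, ⟨hwR, hw⟩, hw0⟩
    exact hw <| (hzeros w hwR hw0).symm.imp_right fun hwZ => mem_biUnion hwZ (hzU w hwZ)
  refine ⟨(F '' K)ᶜ ∩ ⋂ z ∈ Z, O z, Filter.inter_mem
    ((hK.image hF.continuous).isClosed.isOpen_compl.mem_nhds hK0)
    ((Filter.biInter_finset_mem Z).2 fun z hz => hZ z hz ▸ hO z hz), fun φ hφ hφO hφN => ?_⟩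
  have hcont : Continuous fun w => φ (F w) * (fderiv ℝ F w).det :=
    (hφ.comp hF.continuous).mul
      (ContinuousLinearMap.continuous_det.comp (hF.continuous_fderiv one_ne_zero))
  have hvanish : ∀ w ∈ R \ ⋃ z ∈ Z, U z, φ (F w) * (fderiv ℝ F w).det = 0 := by
    rintro w ⟨hwR, hwU⟩
    refine mul_eq_zero_of_left (Function.notMem_support.1 fun hw => ?_) _
    by_cases hwN : w ∈ N
    · exact disjoint_left.1 hφN hw ⟨w, ⟨hwR, hwN⟩, rfl⟩
    · exact (hφO hw).1 ⟨w, ⟨hwR, fun h => h.elim hwN hwU⟩, rfl⟩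
  calc ∫ w in R, φ (F w) * (fderiv ℝ F w).det ∂μ
      = ∫ w in ⋃ z ∈ Z, U z, φ (F w) * (fderiv ℝ F w).det ∂μ :=
        setIntegral_eq_of_subset_of_forall_sdiff_eq_zero hR.measurableSet hUR hvanish
    _ = ∑ z ∈ Z, ∫ w in U z, φ (F w) * (fderiv ℝ F w).det ∂μ :=
        integral_biUnion_finset Z (fun z hz => (hUo z hz).measurableSet) hUdisj fun z hz =>
          (hcont.continuousOn.integrableOn_compact hR).mono_set
            ((subset_biUnion_of_mem (u := U) hz).trans hUR)
    _ = (∑ z ∈ Z, (SignType.sign (fderiv ℝ F z).det : ℝ)) * ∫ p, φ p ∂μ := by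
        rw [Finset.sum_mul]
        exact Finset.sum_congr rfl fun z hz =>
          hint z hz φ fun p hp => mem_iInter₂.1 (hφO hp).2 z hz

end DegreeFormula

section PlaneLoops

/-- The oriented area spanned by two plane vectors, positive if the second one points to the left
of the first. -/
def wedge (u v : ℝ × ℝ) : ℝ := u.1 * v.2 - u.2 * v.1

/-- The difference map of two parametrized plane curves. Its zeros are the intersection points of
the curves, given as pairs of parameters. -/
def differenceMap (α β : ℝ → ℝ × ℝ) (z : ℝ × ℝ) : ℝ × ℝ := β z.2 - α z.1

variable {α β : ℝ → ℝ × ℝ} {a b c d : ℝ}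

theorem map_mul_snd_sub_map_mul_snd (L : ℝ × ℝ →L[ℝ] ℝ) (u v : ℝ × ℝ) :
    L u * v.2 - L v * u.2 = L (1, 0) * wedge u v := by
  have hL (w : ℝ × ℝ) : L w = w.1 * L (1, 0) + w.2 * L (0, 1) := by
    rw [← smul_eq_mul, ← smul_eq_mul, ← map_smul, ← map_smul, ← map_add]
    simp
  rw [hL u, hL v, wedge]
  ring

theorem exists_continuousLinearMap_neg_pos {u v : ℝ × ℝ} (huv : wedge u v ≠ 0) :
    ∃ l : ℝ × ℝ →L[ℝ] ℝ, l u < 0 ∧ 0 < l v := by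
  let l : ℝ × ℝ →L[ℝ] ℝ := wedge u v • ((u + v).1 • ContinuousLinearMap.snd ℝ ℝ ℝ -
    (u + v).2 • ContinuousLinearMap.fst ℝ ℝ ℝ)
  have hl (w : ℝ × ℝ) : l w = wedge u v * ((u.1 + v.1) * w.2 - (u.2 + v.2) * w.1) := rfl
  have hlu : l u = -wedge u v ^ 2 := by rw [hl, wedge]; ring
  have hlv : l v = wedge u v ^ 2 := by rw [hl, wedge]; ring
  have hpos : 0 < wedge u v ^ 2 := by positivity
  exact ⟨l, by linarith, by linarith⟩

theorem contDiff_differenceMap (hα : ContDiff ℝ 1 α) (hβ : ContDiff ℝ 1 β) :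
    ContDiff ℝ 1 (differenceMap α β) :=
  (hβ.comp contDiff_snd).sub (hα.comp contDiff_fst)

theorem hasFDerivAt_differenceMap {z : ℝ × ℝ} (hα : DifferentiableAt ℝ α z.1)
    (hβ : DifferentiableAt ℝ β z.2) :
    HasFDerivAt (differenceMap α β) ((ContinuousLinearMap.snd ℝ ℝ ℝ).smulRight (deriv β z.2) -
      (ContinuousLinearMap.fst ℝ ℝ ℝ).smulRight (deriv α z.1)) z :=
  ((hβ.hasDerivAt.hasFDerivAt.comp z hasFDerivAt_snd).sub
    (hα.hasDerivAt.hasFDerivAt.comp z hasFDerivAt_fst)).congr_fderiv (by ext <;> simp)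

theorem det_fderiv_differenceMap {z : ℝ × ℝ} (hα : DifferentiableAt ℝ α z.1)
    (hβ : DifferentiableAt ℝ β z.2) :
    (fderiv ℝ (differenceMap α β) z).det = -wedge (deriv α z.1) (deriv β z.2) := by
  set u := deriv α z.1
  set v := deriv β z.2
  have hmatrix : LinearMap.toMatrix (Module.Basis.finTwoProd ℝ) (Module.Basis.finTwoProd ℝ)
      (fderiv ℝ (differenceMap α β) z) = !![-u.1, v.1; -u.2, v.2] := by
    rw [(hasFDerivAt_differenceMap hα hβ).fderiv]
    ext i j
    fin_cases i <;> fin_cases j <;> simp [LinearMap.toMatrix_apply, u, v]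
  rw [ContinuousLinearMap.det, ← LinearMap.det_toMatrix (Module.Basis.finTwoProd ℝ), hmatrix,
    Matrix.det_fin_two_of, wedge]
  ring

theorem setIntegral_Icc_fderiv_deriv_eq_zero {H : ℝ × ℝ → ℝ} (hα : ContDiff ℝ 1 α)
    (hH : ContDiff ℝ 1 H) (hab : a ≤ b) (hloop : α a = α b) :
    ∫ s in Icc a b, fderiv ℝ H (α s) (deriv α s) = 0 := by
  have hderiv (s : ℝ) : HasDerivAt (H ∘ α) (fderiv ℝ H (α s) (deriv α s)) s :=
    (hH.differentiable one_ne_zero _).hasFDerivAt.comp_hasDerivAt s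
      (hα.differentiable one_ne_zero s).hasDerivAt
  have hcont : Continuous fun s => fderiv ℝ H (α s) (deriv α s) :=
    ((hH.continuous_fderiv one_ne_zero).comp hα.continuous).clm_apply (hα.continuous_deriv le_rfl)
  rw [integral_Icc_eq_integral_Ioc, ← intervalIntegral.integral_of_le hab,
    intervalIntegral.integral_eq_sub_of_hasDerivAt (fun s _ => hderiv s)
      (hcont.intervalIntegrable _ _), Function.comp_apply, Function.comp_apply, hloop, sub_self]

/-- The plane `2`-form `∂₁H dx ∧ dy` is exact, so its pull-back to the torus of a pair of loops
has integral zero. -/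
theorem setIntegral_fderiv_comp_mul_det_differenceMap_eq_zero {H : ℝ × ℝ → ℝ}
    (hα : ContDiff ℝ 1 α) (hβ : ContDiff ℝ 1 β) (hH : ContDiff ℝ 1 H) (hab : a ≤ b) (hcd : c ≤ d)
    (hαloop : α a = α b) (hβloop : β c = β d) :
    ∫ z in Icc a b ×ˢ Icc c d,
      fderiv ℝ H (differenceMap α β z) (1, 0) * (fderiv ℝ (differenceMap α β) z).det = 0 := by
  set L : ℝ × ℝ → ℝ × ℝ →L[ℝ] ℝ := fun z => fderiv ℝ H (differenceMap α β z)
  have hL : Continuous L :=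
    (hH.continuous_fderiv one_ne_zero).comp (contDiff_differenceMap hα hβ).continuous
  have : Continuous (deriv α) := hα.continuous_deriv le_rfl
  have : Continuous (deriv β) := hβ.continuous_deriv le_rfl
  have hR : IsCompact (Icc a b ×ˢ Icc c d) := isCompact_Icc.prod isCompact_Icc
  have hint {G : ℝ × ℝ → ℝ} (hG : Continuous G) : IntegrableOn G (Icc a b ×ˢ Icc c d) :=
    hG.continuousOn.integrableOn_compact hR
  have hintα : IntegrableOn (fun z => L z (deriv α z.1) * (deriv β z.2).2) _ :=
    hint (by fun_prop)
  have hintβ : IntegrableOn (fun z => L z (deriv β z.2) * (deriv α z.1).2) _ :=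
    hint (by fun_prop)
  have hzeroα : ∫ z in Icc a b ×ˢ Icc c d, L z (deriv α z.1) * (deriv β z.2).2 = 0 := by
    have hinner (t : ℝ) : ∫ s in Icc a b, L (s, t) (deriv α s) = 0 := by
      have := setIntegral_Icc_fderiv_deriv_eq_zero (contDiff_const (c := β t) |>.sub hα) hH hab
        (by rw [hαloop])
      simpa only [deriv_const_sub, map_neg, integral_neg, neg_eq_zero, L, differenceMap] using this
    rw [Measure.volume_eq_prod, ← setIntegral_prod_swap]
    refine (setIntegral_prod _ hintα.swap).trans ?_
    simp only [Function.comp_apply, Prod.swap_prod_mk, integral_mul_const, hinner, zero_mul,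
      integral_zero]
  have hzeroβ : ∫ z in Icc a b ×ˢ Icc c d, L z (deriv β z.2) * (deriv α z.1).2 = 0 := by
    have hinner (s : ℝ) : ∫ t in Icc c d, L (s, t) (deriv β t) = 0 := by
      have := setIntegral_Icc_fderiv_deriv_eq_zero (hβ.sub (contDiff_const (c := α s))) hH hcd
        (by rw [hβloop])
      simpa only [deriv_sub_const, L, differenceMap] using this
    rw [Measure.volume_eq_prod, setIntegral_prod _ hintβ]
    simp only [integral_mul_const, hinner, zero_mul, integral_zero]
  calc ∫ z in Icc a b ×ˢ Icc c d, L z (1, 0) * (fderiv ℝ (differenceMap α β) z).det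
      = ∫ z in Icc a b ×ˢ Icc c d,
          (L z (deriv β z.2) * (deriv α z.1).2 - L z (deriv α z.1) * (deriv β z.2).2) := by
        congr! 2 with z
        rw [det_fderiv_differenceMap (hα.differentiable one_ne_zero _)
          (hβ.differentiable one_ne_zero _), mul_neg, ← map_mul_snd_sub_map_mul_snd, neg_sub]
    _ = 0 := by rw [integral_sub hintβ hintα, hzeroα, hzeroβ, sub_zero]

theorem exists_contDiff_support_fderiv_subset {O : Set (ℝ × ℝ)} (hO : IsOpen O)
    (hne : O.Nonempty) :
    ∃ H : ℝ × ℝ → ℝ, ContDiff ℝ 1 H ∧ Function.support (fun p => fderiv ℝ H p (1, 0)) ⊆ O ∧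
      0 < ∫ p, fderiv ℝ H p (1, 0) := by
  obtain ⟨q, hq⟩ := hne
  obtain ⟨r, hr, hball⟩ := Metric.isOpen_iff.1 hO q hq
  let f : ContDiffBump q.1 := ⟨r / 2, r, half_pos hr, half_lt_self hr⟩
  let k : ContDiffBump q.2 := ⟨r / 2, r, half_pos hr, half_lt_self hr⟩
  let g : ℝ → ℝ := fun x => ∫ y in 0..x, f y
  have hg (x : ℝ) : HasDerivAt g (f x) x := f.continuous.integral_hasStrictDerivAt 0 x |>.hasDerivAt
  have hg' : ContDiff ℝ 1 g := contDiff_one_iff_deriv.2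
    ⟨fun x => (hg x).differentiableAt, (funext fun x => (hg x).deriv) ▸ f.continuous⟩
  have hH : ContDiff ℝ 1 fun p : ℝ × ℝ => g p.1 * k p.2 :=
    (hg'.comp contDiff_fst).mul (k.contDiff.comp contDiff_snd)
  have hderiv (p : ℝ × ℝ) : fderiv ℝ (fun p : ℝ × ℝ => g p.1 * k p.2) p (1, 0) = f p.1 * k p.2 := by
    have hline : HasDerivAt (fun x : ℝ => (x, p.2)) ((1, 0) : ℝ × ℝ) p.1 :=
      (hasDerivAt_id p.1).prodMk (hasDerivAt_const p.1 p.2)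
    exact ((hH.differentiable one_ne_zero p).hasFDerivAt.comp_hasDerivAt p.1 hline).unique
      ((hg p.1).mul_const (k p.2))
  refine ⟨_, hH, ?_, ?_⟩ <;> simp only [hderiv]
  · refine Subset.trans (fun p hp => ?_) hball
    rw [← ball_prod_same, ← f.support_eq, ← k.support_eq]
    exact ⟨left_ne_zero_of_mul hp, right_ne_zero_of_mul hp⟩
  · rw [Measure.volume_eq_prod, integral_prod_mul (f : ℝ → ℝ) (k : ℝ → ℝ)]
    exact mul_pos f.integral_pos k.integral_pos

theorem exists_isOpen_forall_Icc_le {f : ℝ → ℝ} (ha : deriv f a < 0) (hb : 0 < deriv f b)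
    (hab : f a = f b) : ∃ V, IsOpen V ∧ a ∈ V ∧ b ∈ V ∧ ∀ s ∈ Icc a b, s ∈ V → f s ≤ f a := by
  have hright : ∀ᶠ s in 𝓝 a, s ∈ Icc a b → f s ≤ f a := by
    filter_upwards [eventually_nhdsWithin_sign_eq_of_deriv_neg (f := fun s => f s - f a)
      (by rwa [deriv_sub_const]) (sub_self _)] with s hs hsab
    have : SignType.sign (f s - f a) ≤ 0 := hs ▸ sign_nonpos_iff.2 (sub_nonpos.2 hsab.1)
    exact sub_nonpos.1 (sign_nonpos_iff.1 this)
  have hleft : ∀ᶠ s in 𝓝 b, s ∈ Icc a b → f s ≤ f b := by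
    filter_upwards [eventually_nhdsWithin_sign_eq_of_deriv_pos (f := fun s => f s - f b)
      (by rwa [deriv_sub_const]) (sub_self _)] with s hs hsab
    have : SignType.sign (f s - f b) ≤ 0 := hs ▸ sign_nonpos_iff.2 (sub_nonpos.2 hsab.2)
    exact sub_nonpos.1 (sign_nonpos_iff.1 this)
  obtain ⟨V, hV, hVo, haV⟩ := eventually_nhds_iff.1 hright
  obtain ⟨W, hW, hWo, hbW⟩ := eventually_nhds_iff.1 hleft
  refine ⟨V ∪ W, hVo.union hWo, Or.inl haV, Or.inr hbW, fun s hs hsVW => ?_⟩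
  exact hsVW.elim (fun h => hV s h hs) (fun h => hab ▸ hW s h hs)

theorem mem_Ioo_prod_or_mem_corners {X : Type*} {α β : ℝ → X} {p : X} {z : ℝ × ℝ}
    (hαp : ∀ s ∈ Icc a b, α s = p ↔ s = a ∨ s = b) (hβp : ∀ t ∈ Icc c d, β t = p ↔ t = c ∨ t = d)
    (hz : z ∈ Icc a b ×ˢ Icc c d) (heq : α z.1 = β z.2) :
    z ∈ Ioo a b ×ˢ Ioo c d ∨ (z.1 = a ∨ z.1 = b) ∧ (z.2 = c ∨ z.2 = d) := by
  have hαz := hαp z.1 hz.1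
  have hβz := hβp z.2 hz.2
  by_cases hp : β z.2 = p
  · exact Or.inr ⟨hαz.1 (heq.trans hp), hβz.1 hp⟩
  · obtain ⟨hza, hzb⟩ := not_or.1 (mt hαz.2 (heq ▸ hp))
    obtain ⟨hzc, hzd⟩ := not_or.1 (mt hβz.2 hp)
    exact Or.inl ⟨⟨hz.1.1.lt_of_ne' hza, hz.1.2.lt_of_ne hzb⟩,
      ⟨hz.2.1.lt_of_ne' hzc, hz.2.2.lt_of_ne hzd⟩⟩

theorem exists_mem_map_neg {O : Set (ℝ × ℝ)} {l : ℝ × ℝ →L[ℝ] ℝ} {u : ℝ × ℝ} (hO : O ∈ 𝓝 0)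
    (hu : l u < 0) : ∃ q ∈ O, l q < 0 := by
  have htendsto : Filter.Tendsto (fun x : ℝ => x • u) (𝓝[>] 0) (𝓝 0) :=
    ((continuous_id.smul continuous_const).tendsto' 0 0 (zero_smul ℝ u)).mono_left
      nhdsWithin_le_nhds
  obtain ⟨x, hxO, hx⟩ := ((htendsto.eventually_mem hO).and self_mem_nhdsWithin).exists
  exact ⟨x • u, hxO, by rw [map_smul]; exact mul_neg_of_pos_of_neg hx hu⟩

/-- The zeros in `N` do not count because a bump form near `0` supported in the half-plane `l < 0`
does not see them. -/
theorem sum_sign_wedge_eq_zero_of_map_le {l : ℝ × ℝ →L[ℝ] ℝ} {u : ℝ × ℝ} {N : Set (ℝ × ℝ)}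
    {Z : Finset (ℝ × ℝ)} (hα : ContDiff ℝ 1 α) (hβ : ContDiff ℝ 1 β) (hab : a ≤ b) (hcd : c ≤ d)
    (hαloop : α a = α b) (hβloop : β c = β d) (hN : IsOpen N)
    (hZR : ∀ z ∈ Z, Icc a b ×ˢ Icc c d ∈ 𝓝 z) (hZ : ∀ z ∈ Z, α z.1 = β z.2)
    (htransverse : ∀ z ∈ Z, wedge (deriv α z.1) (deriv β z.2) ≠ 0)
    (hzeros : ∀ z ∈ Icc a b ×ˢ Icc c d, α z.1 = β z.2 → z ∈ Z ∨ z ∈ N)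
    (hu : l u < 0) (hle : ∀ z ∈ Icc a b ×ˢ Icc c d ∩ N, l (α z.1) ≤ l (β z.2)) :
    ∑ z ∈ Z, (SignType.sign (wedge (deriv α z.1) (deriv β z.2)) : ℤ) = 0 := by
  have hdet (z : ℝ × ℝ) := det_fderiv_differenceMap (z := z) (hα.differentiable one_ne_zero _)
    (hβ.differentiable one_ne_zero _)
  have hnonneg : ∀ p ∈ differenceMap α β '' (Icc a b ×ˢ Icc c d ∩ N), 0 ≤ l p := by
    rintro _ ⟨z, hz, rfl⟩
    rw [differenceMap, map_sub, sub_nonneg]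
    exact hle z hz
  obtain ⟨O, hO, hdegree⟩ := exists_nhds_zero_setIntegral_comp_mul_det volume
    (contDiff_differenceMap hα hβ) (isCompact_Icc.prod isCompact_Icc) hN hZR
    (fun z hz => sub_eq_zero.2 (hZ z hz).symm)
    (fun z hz => by rw [hdet]; exact neg_ne_zero.2 (htransverse z hz))
    (fun z hzR hz => hzeros z hzR (sub_eq_zero.1 hz).symm)
  obtain ⟨q, hq⟩ := exists_mem_map_neg (interior_mem_nhds.2 hO) hu
  obtain ⟨H, hH, hsupp, hpos⟩ := exists_contDiff_support_fderiv_subset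
    (isOpen_interior.inter (isOpen_lt l.continuous continuous_const)) ⟨q, hq⟩
  have hsum := hdegree (fun p => fderiv ℝ H p (1, 0))
    ((hH.continuous_fderiv one_ne_zero).clm_apply continuous_const)
    (fun p hp => interior_subset (hsupp hp).1)
    (disjoint_left.2 fun p hp hpN => (hnonneg p hpN).not_gt (hsupp hp).2)
  rw [setIntegral_fderiv_comp_mul_det_differenceMap_eq_zero hα hβ hH hab hcd hαloop hβloop,
    eq_comm, mul_eq_zero, or_iff_left hpos.ne'] at hsum
  simp only [hdet, Left.sign_neg, SignType.coe_neg, Finset.sum_neg_distrib, neg_eq_zero] at hsum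
  rw [← Int.cast_eq_zero (α := ℝ), Int.cast_sum]
  simpa only [SignType.intCast_cast] using hsum

/-- The signs of `l` make the loops touch at `p` without crossing: near `p` the first one lies in
`l ≤ l p` and the second one in `l p ≤ l`. -/
theorem sum_sign_wedge_eq_zero {l : ℝ × ℝ →L[ℝ] ℝ} {p : ℝ × ℝ} {Z : Finset (ℝ × ℝ)}
    (hα : ContDiff ℝ 1 α) (hβ : ContDiff ℝ 1 β) (hab : a ≤ b) (hcd : c ≤ d)
    (hαp : ∀ s ∈ Icc a b, α s = p ↔ s = a ∨ s = b) (hβp : ∀ t ∈ Icc c d, β t = p ↔ t = c ∨ t = d)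
    (hla : l (deriv α a) < 0) (hlb : 0 < l (deriv α b))
    (hlc : 0 < l (deriv β c)) (hld : l (deriv β d) < 0)
    (hZ : ∀ z, z ∈ Z ↔ z ∈ Ioo a b ×ˢ Ioo c d ∧ α z.1 = β z.2)
    (htransverse : ∀ z ∈ Z, wedge (deriv α z.1) (deriv β z.2) ≠ 0) :
    ∑ z ∈ Z, (SignType.sign (wedge (deriv α z.1) (deriv β z.2)) : ℤ) = 0 := by
  have ha : α a = p := (hαp a (left_mem_Icc.2 hab)).2 (Or.inl rfl)
  have hb : α b = p := (hαp b (right_mem_Icc.2 hab)).2 (Or.inr rfl)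
  have hc : β c = p := (hβp c (left_mem_Icc.2 hcd)).2 (Or.inl rfl)
  have hd : β d = p := (hβp d (right_mem_Icc.2 hcd)).2 (Or.inr rfl)
  have hderiv {γ : ℝ → ℝ × ℝ} (hγ : ContDiff ℝ 1 γ) (s : ℝ) : deriv (l ∘ γ) s = l (deriv γ s) :=
    (l.hasFDerivAt.comp_hasDerivAt s (hγ.differentiable one_ne_zero s).hasDerivAt).deriv
  obtain ⟨V, hVo, haV, hbV, hV⟩ := exists_isOpen_forall_Icc_le (f := l ∘ α) (a := a) (b := b)
    (by rwa [hderiv hα]) (by rwa [hderiv hα]) (by simp only [Function.comp_apply, ha, hb])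
  obtain ⟨W, hWo, hcW, hdW, hW⟩ := exists_isOpen_forall_Icc_le (f := -(l ∘ β)) (a := c) (b := d)
    (by rwa [deriv.neg, hderiv hβ, neg_lt_zero]) (by rwa [deriv.neg, hderiv hβ, neg_pos])
    (by simp only [Pi.neg_apply, Function.comp_apply, hc, hd])
  refine sum_sign_wedge_eq_zero_of_map_le hα hβ hab hcd (ha.trans hb.symm) (hc.trans hd.symm)
    (hVo.prod hWo) (fun z hz => ?_) (fun z hz => ((hZ z).1 hz).2) htransverse
    (fun z hzR hz => ?_) hla fun z hz => ?_
  · obtain ⟨⟨hs, ht⟩, -⟩ := (hZ z).1 hz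
    exact prod_mem_nhds (Icc_mem_nhds hs.1 hs.2) (Icc_mem_nhds ht.1 ht.2)
  · refine (mem_Ioo_prod_or_mem_corners hαp hβp hzR hz).imp (fun h => (hZ z).2 ⟨h, hz⟩) ?_
    rintro ⟨rfl | rfl, rfl | rfl⟩ <;> exact ⟨‹_›, ‹_›⟩
  · calc l (α z.1) ≤ l (α a) := hV z.1 hz.1.1 hz.2.1
      _ = l (β c) := by rw [ha, hc]
      _ ≤ l (β z.2) := neg_le_neg_iff.1 (hW z.2 hz.1.2 hz.2.2)

end PlaneLoops

namespace ImmersedClosedCurve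

variable (γ : ImmersedClosedCurve)

theorem point_coe (s : ℝ) : γ.point s = γ.curve s :=
  γ.periodic.lift_coe s

theorem det_coe (s t : ℝ) : γ.det s t = wedge (deriv γ.curve s) (deriv γ.curve t) := by
  have velocity_coe (x : ℝ) : γ.velocity x = deriv γ.curve x := γ.periodic_deriv.lift_coe x
  simp only [det, wedge, velocity_coe]

theorem sign_det_swap (s t : UnitAddCircle) :
    (SignType.sign (γ.det s t) : ℤ) = -(SignType.sign (γ.det t s) : ℤ) := by
  have det_swap : γ.det s t = -γ.det t s := by simp only [det]; ring
  rw [det_swap, Left.sign_neg, SignType.coe_neg]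

variable {γ}

theorem swap_mem_doublePairs {p : UnitAddCircle × UnitAddCircle} (hp : p ∈ γ.doublePairs) :
    p.swap ∈ γ.doublePairs :=
  ⟨hp.1.symm, hp.2.symm⟩

theorem bijOn_coe_doublePairs {a b : ℝ} (hb : b ∈ Ioo a (a + 1)) :
    BijOn (Prod.map ((↑) : ℝ → UnitAddCircle) ((↑) : ℝ → UnitAddCircle))
      {z | z ∈ Ioo a b ×ˢ Ioo b (a + 1) ∧ γ.curve z.1 = γ.curve z.2}
      {p | p ∈ γ.doublePairs ∧ p.1 ∈ cIoo (a : UnitAddCircle) b ∧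
        p.2 ∈ cIoo (b : UnitAddCircle) a} := by
  have hab := bijOn_coe_Ioo_cIoo (p := (1 : ℝ)) (Ioo_subset_Ico_self hb)
  have hba := bijOn_coe_Ioo_cIoo (p := (1 : ℝ)) (a := b) (b := a + 1)
    ⟨hb.2.le, add_lt_add_left hb.1 1⟩
  rw [AddCircle.coe_add_period] at hba
  refine ⟨?_, (hab.injOn.prodMap hba.injOn).mono fun z hz => hz.1, ?_⟩
  · rintro ⟨s, t⟩ ⟨⟨hs, ht⟩, hst⟩
    refine ⟨⟨?_, ?_⟩, hab.mapsTo hs, hba.mapsTo ht⟩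
    · exact (disjoint_cIoo_swap _ _).ne_of_mem (hab.mapsTo hs) (hba.mapsTo ht)
    · simpa only [Prod.map_fst, Prod.map_snd, point_coe] using hst
  · rintro ⟨x, y⟩ ⟨hxy, hx, hy⟩
    obtain ⟨s, hs, rfl⟩ := hab.surjOn hx
    obtain ⟨t, ht, rfl⟩ := hba.surjOn hy
    exact ⟨(s, t), ⟨⟨hs, ht⟩, by simpa only [point_coe] using hxy.2⟩, rfl⟩

end ImmersedClosedCurve

namespace VirtualKnotDiagram

variable {D : VirtualKnotDiagram} {u o s : UnitAddCircle}

theorem point_eq_iff (huo : (u, o) ∈ D.doublePairs) :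
    D.point s = D.point u ↔ s = u ∨ s = o := by
  refine ⟨fun h => or_iff_not_imp_left.2 fun hsu => ?_, ?_⟩
  · exact (D.no_triple u o s huo ⟨Ne.symm hsu, h.symm⟩).symm
  · rintro (rfl | rfl)
    exacts [rfl, huo.2.symm]

theorem curve_eq_iff {a b x : ℝ} (hab : ((a : UnitAddCircle), (b : UnitAddCircle)) ∈ D.doublePairs)
    (hb : b ∈ Ico a (a + 1)) (hx : x ∈ Icc a b) : D.curve x = D.curve a ↔ x = a ∨ x = b := by
  have ha : a ∈ Ico a (a + 1) := ⟨le_rfl, hb.1.trans_lt hb.2⟩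
  have hx' : x ∈ Ico a (a + 1) := ⟨hx.1, hx.2.trans_lt hb.2⟩
  rw [← D.point_coe, ← D.point_coe, point_eq_iff hab,
    AddCircle.coe_eq_coe_iff_of_mem_Ico hx' ha, AddCircle.coe_eq_coe_iff_of_mem_Ico hx' hb]

theorem snd_notMem_cIoo_iff {p : UnitAddCircle × UnitAddCircle} (huo : (u, o) ∈ D.doublePairs)
    (hp : p ∈ D.doublePairs) (hp₁ : p.1 ∈ cIoo u o) : p.2 ∉ cIoo u o ↔ p.2 ∈ cIoo o u := by
  have hpu : D.point p.2 ≠ D.point u := by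
    rw [← hp.2, Ne, point_eq_iff huo]
    rintro (h | h)
    · exact left_notMem_cIoo (h ▸ hp₁)
    · exact right_notMem_cIoo (h ▸ hp₁)
  obtain ⟨hu, ho⟩ := not_or.1 (mt (point_eq_iff huo).2 hpu)
  exact ⟨(mem_cIoo_or_mem_cIoo_swap huo.1 hu ho).resolve_left,
    fun h => disjoint_right.1 (disjoint_cIoo_swap u o) h⟩

open Classical in
theorem sum_sign_det_halves_eq_zero (huo : (u, o) ∈ D.doublePairs) :
    ∑ p ∈ D.finite_doublePairs.toFinset with p.1 ∈ cIoo u o ∧ p.2 ∈ cIoo o u,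
      (SignType.sign (D.det p.1 p.2) : ℤ) = 0 := by
  obtain ⟨a, rfl⟩ := QuotientAddGroup.mk_surjective u
  obtain ⟨b, hb, rfl⟩ := (AddCircle.coe_image_Ico_eq 1 a).ge (mem_univ o)
  have hab : a < b := hb.1.lt_of_ne fun h => huo.1 (h ▸ rfl)
  have hba : a + 1 ∈ Ico b (b + 1) := ⟨hb.2.le, add_lt_add_left hab 1⟩
  have hou : ((b : UnitAddCircle), ((a + 1 : ℝ) : UnitAddCircle)) ∈ D.doublePairs := by
    rw [AddCircle.coe_add_period]
    exact ImmersedClosedCurve.swap_mem_doublePairs huo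
  have hcurve : D.curve a = D.curve b := by simpa only [D.point_coe] using huo.2
  have hbij := D.bijOn_coe_doublePairs ⟨hab, hb.2⟩
  have hfin := hbij.finite_iff_finite.2 (D.finite_doublePairs.subset fun p hp => hp.1)
  obtain ⟨l, hla, hlb⟩ := exists_continuousLinearMap_neg_pos
    (D.det_coe a b ▸ D.transverse _ _ huo)
  have hzero := sum_sign_wedge_eq_zero (Z := hfin.toFinset) D.contDiff D.contDiff hb.1 hba.1
    (fun x hx => curve_eq_iff huo hb hx) (fun x hx => hcurve ▸ curve_eq_iff hou hba hx)
    hla hlb hlb (by rwa [D.periodic_deriv a]) (fun z => hfin.mem_toFinset) fun z hz => by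
      rw [← D.det_coe]
      exact D.transverse _ _ (hbij.mapsTo (hfin.mem_toFinset.1 hz)).1
  rw [← hzero, eq_comm]
  have hbij' : BijOn (Prod.map ((↑) : ℝ → UnitAddCircle) ((↑) : ℝ → UnitAddCircle)) hfin.toFinset
      (D.finite_doublePairs.toFinset.filter fun p =>
        p.1 ∈ cIoo (a : UnitAddCircle) b ∧ p.2 ∈ cIoo (b : UnitAddCircle) a) := by
    simpa only [Finset.coe_filter, Finite.coe_toFinset, Finite.mem_toFinset] using hbij
  exact Finset.sum_nbij _ hbij'.mapsTo hbij'.injOn hbij'.surjOn fun z _ => by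
    rw [← D.det_coe]; rfl

open Classical in
theorem sum_sign_det_eq_zero (huo : (u, o) ∈ D.doublePairs) :
    ∑ p ∈ D.finite_doublePairs.toFinset with p.1 ∈ cIoo u o,
      (SignType.sign (D.det p.1 p.2) : ℤ) = 0 := by
  have hself : ∑ p ∈ D.finite_doublePairs.toFinset with p.1 ∈ cIoo u o ∧ p.2 ∈ cIoo u o,
      (SignType.sign (D.det p.1 p.2) : ℤ) = 0 := by
    refine Finset.sum_involution (fun p _ => p.swap) (fun p _ => ?_) (fun p hp _ h => ?_)
      (fun p hp => ?_) fun p _ => p.swap_swap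
    · rw [Prod.fst_swap, Prod.snd_swap, D.sign_det_swap p.2 p.1, add_neg_cancel]
    · exact (D.finite_doublePairs.mem_toFinset.1 (Finset.mem_filter.1 hp).1).1
        (congrArg Prod.snd h)
    · simp only [Finset.mem_filter, Finite.mem_toFinset] at hp ⊢
      exact ⟨ImmersedClosedCurve.swap_mem_doublePairs hp.1, hp.2.2, hp.2.1⟩
  rw [← Finset.sum_filter_add_sum_filter_not _ fun p => p.2 ∈ cIoo u o, Finset.filter_filter,
    Finset.filter_filter, hself, zero_add, ← sum_sign_det_halves_eq_zero huo]
  refine Finset.sum_congr (Finset.filter_congr fun p hp => and_congr_right ?_) fun _ _ => rfl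
  exact snd_notMem_cIoo_iff huo (D.finite_doublePairs.mem_toFinset.1 hp)

theorem fst_notMem_classicalPassages {p : UnitAddCircle × UnitAddCircle}
    (hp : p ∈ D.virtualPairs) : p.1 ∉ D.classicalPassages := by
  rintro ⟨q, hq, hqp⟩
  have hqd : (p.1, q.2) ∈ D.doublePairs := hqp ▸ D.classicalPairs_subset hq
  have hpq : p = q := Prod.ext hqp.symm (D.no_triple p.1 p.2 q.2 hp.1 hqd)
  exact hp.2 (hpq ▸ hq)

theorem LongArc.eq_of_mem_interior {e e' : D.LongArc} (hs : s ∈ e.interior)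
    (hs' : s ∈ e'.interior) : e = e' := by
  obtain ⟨ha, hb, -, hab⟩ := e.2
  obtain ⟨ha', hb', -, hab'⟩ := e'.2
  refine Subtype.ext (Prod.ext ?_ ?_)
  · exact left_eq_left_of_notMem_cIoo hs hs' (disjoint_right.1 hab' ha) (disjoint_right.1 hab ha')
  · exact right_eq_right_of_notMem_cIoo hs hs' (disjoint_right.1 hab' hb)
      (disjoint_right.1 hab hb')

theorem exists_longArc_interior_subset (hu : u ∈ D.classicalPassages)
    (ho : o ∈ D.classicalPassages) (hs : s ∉ D.classicalPassages) (hsuo : s ∈ cIoo u o) :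
    ∃ e : D.LongArc, s ∈ e.interior ∧ e.interior ⊆ cIoo u o := by
  have hfin : D.classicalPassages.Finite := D.finite_classicalPairs.image _
  obtain ⟨a, ha, b, hb, hsab, hab⟩ :=
    exists_mem_cIoo_disjoint hfin hs hu ho (ne_of_mem_cIoo hsuo)
  exact ⟨⟨(a, b), ha, hb, ne_of_mem_cIoo hsab, hab⟩, hsab, cIoo_subset_cIoo_of_notMem hsab hsuo
    (disjoint_right.1 hab hu) (disjoint_right.1 hab ho)⟩

open Classical in
theorem eval_virtualIndexCocycle (hu : u ∈ D.classicalPassages) (ho : o ∈ D.classicalPassages) :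
    eval D.virtualIndexCocycle ⟨u, o⟩ =
      ∑ p ∈ D.finite_virtualPairs.toFinset with p.1 ∈ cIoo u o,
        (SignType.sign (D.det p.1 p.2) : ℤ) := by
  simp only [eval, virtualIndexCocycle]
  rw [← Finset.sum_biUnion]
  · refine Finset.sum_congr (Finset.ext fun p => ?_) fun _ _ => rfl
    simp only [Finset.mem_biUnion, Finset.mem_filter, Finset.mem_univ, true_and,
      Finite.mem_toFinset]
    constructor
    · rintro ⟨e, he, hp, hpe⟩
      exact ⟨hp, he hpe⟩
    · rintro ⟨hp, hpuo⟩
      obtain ⟨e, hpe, he⟩ :=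
        exists_longArc_interior_subset hu ho (fst_notMem_classicalPassages hp) hpuo
      exact ⟨e, he, hp, hpe⟩
  · refine fun e _ e' _ hne => Finset.disjoint_filter.2 fun p _ hpe hpe' => hne ?_
    exact LongArc.eq_of_mem_interior hpe hpe'

theorem Crossing.positiveHalf_eq (c : D.Crossing) : c.positiveHalf = ⟨c.under, c.over⟩ := by
  have hdet : D.det c.over c.under ≠ 0 := D.transverse _ _ (D.crossings_subset c.2)
  rcases hdet.lt_or_gt with h | h
  · have hsign : c.sign ≠ 1 := by rw [Crossing.sign, sign_neg h]; decide
    rw [positiveHalf, if_neg hsign, rightHalf, if_neg h.not_gt]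
  · have hsign : c.sign = 1 := by rw [Crossing.sign, sign_pos h, SignType.coe_one]
    rw [positiveHalf, if_pos hsign, leftHalf, if_pos h]

end VirtualKnotDiagram

open VirtualKnotDiagram in
open Classical in
theorem mainTheorem2 (D : VirtualKnotDiagram) (c : D.Crossing) :
    D.virtualIndex c = D.index c := by
  have hunder : (c.under, c.over) ∈ D.classicalPairs := Or.inr c.2
  have hover : (c.over, c.under) ∈ D.classicalPairs := Or.inl c.2
  have hzero := sum_sign_det_eq_zero (D.classicalPairs_subset hunder)
  have hdisj : Disjoint D.finite_virtualPairs.toFinset D.finite_classicalPairs.toFinset := by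
    rw [Set.Finite.disjoint_toFinset]
    exact disjoint_sdiff_left
  have hunion : D.finite_doublePairs.toFinset =
      D.finite_virtualPairs.toFinset ∪ D.finite_classicalPairs.toFinset := by
    ext p
    simp only [Set.Finite.mem_toFinset, Finset.mem_union, virtualPairs]
    rw [← Set.mem_union, Set.sdiff_union_of_subset D.classicalPairs_subset]
  rw [hunion, Finset.filter_union, Finset.sum_union (Finset.disjoint_filter_filter hdisj)] at hzero
  rw [virtualIndex, index, c.positiveHalf_eq, eval_virtualIndexCocycle ⟨_, hunder, rfl⟩
    ⟨_, hover, rfl⟩, eq_neg_of_add_eq_zero_left hzero, ← Finset.sum_neg_distrib]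
  exact Finset.sum_congr rfl fun p _ => (D.sign_det_swap p.2 p.1).symm
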